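/- Let $u$ be a negative integer, put $v=-u$, let $n$ be a positive integer, and let $$\mathcal{L}_n^{(u)}(x)=\sum_{j=0}^{n}\binom{n}{j}\Big(\prod_{i=j+1}^{n}\big(1+2(u+i)\big)\Big)x^j\in\mathbb{Q}[x].$$ Assume that $\mathcal{L}_n^{(u)}(x)$ is irreducible over $\mathbb{Q}$ and that $n\ge\max\{14,\,2v-1\}$. If there is a prime $p$ with $2v-3<p<n-2$, then the Galois group of $\mathcal{L}_n^{(u)}(x)$ over $\mathbb{Q}$, regarded as a group of permutations of the $n$ roots of $\mathcal{L}_n^{(u)}(x)$ in $\mathbb{C}$, contains the alternating group $A_n$. -/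

import Mathlib

open Polynomial

attribute [local instance] Polynomial.Gal.splits_ℚ_ℂ

/-- The rescaled generalised Laguerre polynomial
`∑_{j=0}^n (n choose j) (1 + 2(u+n)) (1 + 2(u+n-1)) ⋯ (1 + 2(u+j+1)) x^j`,
as a polynomial over `ℚ` (for `j = n` the product is empty). -/
noncomputable def scaledLaguerre (n : ℕ) (u : ℤ) : ℚ[X] :=
  ∑ j ∈ Finset.range (n + 1),
    C ((n.choose j : ℚ) * ∏ i ∈ Finset.Icc (j + 1) n, (1 + 2 * ((u : ℚ) + (i : ℚ)))) * X ^ j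

/-- The Galois group of `f` over `ℚ`, as the group of permutations of the complex roots of `f`
that are induced by the automorphisms of the splitting field of `f`. -/
noncomputable def galoisPermGroup (f : ℚ[X]) : Subgroup (Equiv.Perm (f.rootSet ℂ)) :=
  (Gal.galActionHom f ℂ).range

/-- The Galois group of `f` over `ℚ` contains `A_n`: the complex roots of `f` can be numbered by
`Fin n` (so there are exactly `n` of them), and after this numbering every even permutation of
`Fin n` comes from the Galois group. -/
def GaloisGroupContainsAlternating (f : ℚ[X]) (n : ℕ) : Prop :=
  ∃ e : f.rootSet ℂ ≃ Fin n,
    alternatingGroup (Fin n) ≤ (galoisPermGroup f).map e.permCongrHom.toMonoidHom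

/-! One may take `p` with `n / 2 < p < n - 2`: a prime `p ≤ n / 2` is exchanged for a larger one by
a sharpened Bertrand postulate. The coefficients are products of odd numbers `1 + 2(i - v)`, of
which, for `1 ≤ i ≤ n`, only those equal to `p` and perhaps `3p` are divisible by `p`. So the Newton
polygon at `p` has an edge of slope `-1/p` (`hasNewtonEdge_intScaledLaguerre`). At a prime of the
splitting field over `p`, a root belonging to this edge has `p` times its valuation equal to the
ramification index. Hence `p` divides the order of the Galois group
(`Polynomial.HasNewtonEdge.dvd_card_gal`). An element of order `p` in a group of permutations of `n
< 2p` points is a `p`-cycle. Irreducibility gives transitivity, and Jordan's theorem on `p`-cycles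
(`alternatingGroup_le_of_isPretransitive_of_isCycle_mem`) gives `A_n`. -/

theorem Nat.Prime.sq_not_dvd_factorial {p n : ℕ} (hp : p.Prime) (hn : n < 2 * p) :
    ¬ p ^ 2 ∣ n.factorial := by
  have hlog : Nat.log p n < 2 :=
    Nat.log_lt_of_lt_pow' two_ne_zero (by nlinarith [hp.two_le])
  rw [hp.pow_dvd_factorial_iff hlog]
  simp only [Nat.Ico_succ_singleton, Finset.sum_singleton, pow_one, not_le]
  exact (Nat.div_lt_iff_lt_mul hp.pos).2 hn

/-! ### Jordan's theorem for transitive groups containing a long `p`-cycle. -/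

namespace Equiv.Perm

open MulAction Subgroup

variable {α : Type*} [Fintype α] [DecidableEq α] {G : Subgroup (Perm α)}

omit [Fintype α] [DecidableEq α] in
theorem exists_mem_eqOn_of_isMultiplyPretransitive {s : Finset α}
    (hG : IsMultiplyPretransitive G α s.card) (τ : Perm α) :
    ∃ x ∈ G, ∀ d ∈ s, x d = τ d := by
  let f : Fin s.card ↪ α := s.equivFin.symm.toEmbedding.trans (Function.Embedding.subtype _)
  obtain ⟨x, hx⟩ := hG.exists_smul_eq f (f.trans τ.toEmbedding)
  refine ⟨x, x.2, fun d hd => ?_⟩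
  have := DFunLike.congr_fun hx (s.equivFin ⟨d, hd⟩)
  simpa [f, Subgroup.smul_def] using this

/-- On the support of a cycle, a commuting permutation acts as a power of that cycle. -/
theorem IsCycle.pow_apply_eq_of_commute {σ g : Perm α} (hσ : σ.IsCycle) (h : Commute g σ) {p : ℕ}
    (hp : σ.support.card = p) {x : α} (hx : σ x ≠ x) : (g ^ p) x = x := by
  have hgx : σ (g x) ≠ g x := by
    have : σ (g x) = g (σ x) := (DFunLike.congr_fun h.eq x).symm
    rw [this]
    exact fun h' => hx (g.injective h')
  obtain ⟨i, hi⟩ := hσ.sameCycle hx hgx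
  have key : ∀ m : ℕ, (g ^ m) x = ((σ ^ i) ^ m) x := by
    intro m
    induction m with
    | zero => simp
    | succ m ih =>
      have hc : Commute g ((σ ^ i) ^ m) := (h.zpow_right i).pow_right m
      rw [pow_succ', mul_apply, ih, ← mul_apply, hc.eq, mul_apply, ← hi, pow_succ, mul_apply]
  rw [key, ← zpow_natCast, ← zpow_mul, mul_comm, zpow_mul, zpow_natCast, ← hp, ← hσ.orderOf,
    pow_orderOf_eq_one, one_zpow, one_apply]

/-- Sylow's theorem in the pointwise stabilizer of the fixed points of `σ` corrects `x` to an
element normalizing the group generated by `σ`. -/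
theorem exists_conj_eq_zpow {p : ℕ} (hp : p.Prime) (hcard : Fintype.card α < 2 * p)
    {σ x : Perm α} (hσ : orderOf σ = p) (hσG : σ ∈ G) (hxG : x ∈ G)
    (hx : ∀ d, σ d = d → σ (x⁻¹ d) = x⁻¹ d) :
    ∃ y ∈ G, (∀ d, σ (x d) = x d → y d = x d) ∧ ∃ i : ℤ, y * σ * y⁻¹ = σ ^ i := by
  have : Fact p.Prime := ⟨hp⟩
  let H : Subgroup (Perm α) := G ⊓ fixingSubgroup (Perm α) {d | σ d = d}
  have hσH : σ ∈ H := ⟨hσG, fun d => d.2⟩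
  have hσ'H : x * σ * x⁻¹ ∈ H := by
    refine ⟨G.mul_mem (G.mul_mem hxG hσG) (G.inv_mem hxG), fun d => ?_⟩
    change x (σ (x⁻¹ d)) = d
    rw [hx d d.2]
    simp
  -- As `p ^ 2 ∤ n!`, the Sylow `p`-subgroups of `H` have order `p`; both `σ` and its conjugate by
  -- `x` generate one.
  have hfac : (Nat.card H).factorization p = 1 := by
    apply le_antisymm
    · rw [← Nat.lt_succ_iff]
      by_contra! h
      have h2 : p ^ 2 ∣ Nat.card H :=
        (hp.pow_dvd_iff_le_factorization Nat.card_pos.ne').2 h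
      refine hp.sq_not_dvd_factorial hcard ?_
      rw [← Fintype.card_perm, ← Nat.card_eq_fintype_card]
      exact h2.trans (card_subgroup_dvd_card H)
    · rw [← hp.dvd_iff_one_le_factorization Nat.card_pos.ne', ← hσ,
        ← Subgroup.orderOf_mk σ hσH]
      exact orderOf_dvd_natCard _
  have hord' : orderOf (x * σ * x⁻¹) = p := by
    rw [← hσ]
    exact orderOf_injective (MulAut.conj x).toMonoidHom (MulAut.conj x).injective σ
  let P : Sylow p H := Sylow.ofCard (zpowers ⟨_, hσ'H⟩) (by
    rw [hfac, pow_one, Nat.card_zpowers, Subgroup.orderOf_mk, hord'])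
  let Q : Sylow p H := Sylow.ofCard (zpowers ⟨_, hσH⟩) (by
    rw [hfac, pow_one, Nat.card_zpowers, Subgroup.orderOf_mk, hσ])
  obtain ⟨h, hh⟩ := MulAction.exists_smul_eq H P Q
  have hmem : h * ⟨_, hσ'H⟩ * h⁻¹ ∈ (Q : Subgroup H) := by
    rw [← hh, Sylow.coe_subgroup_smul]
    exact Subgroup.smul_mem_pointwise_smul _ (MulAut.conj h) _ (mem_zpowers _)
  obtain ⟨i, hi⟩ := mem_zpowers_iff.1 hmem
  refine ⟨h * x, G.mul_mem h.2.1 hxG, fun d hd => ?_, i, ?_⟩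
  · exact h.2.2 ⟨x d, hd⟩
  · have := congrArg (Subtype.val) hi
    simp only [Subgroup.coe_zpow, Subgroup.coe_mul, Subgroup.coe_inv] at this
    rw [this]
    group

omit [Fintype α] [DecidableEq α] in
-- The automorphism group of a cyclic group is abelian, so commutators of its normalizer centralize
-- it.
theorem commute_commutator_of_conj_eq_zpow {σ x y : Perm α} {i j : ℤ}
    (hx : x * σ * x⁻¹ = σ ^ i) (hy : y * σ * y⁻¹ = σ ^ j) :
    Commute (x⁻¹ * y⁻¹ * x * y) σ := by
  have hxy : (x * y) * σ * (x * y)⁻¹ = (y * x) * σ * (y * x)⁻¹ := by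
    calc (x * y) * σ * (x * y)⁻¹ = x * (y * σ * y⁻¹) * x⁻¹ := by group
      _ = y * (x * σ * x⁻¹) * y⁻¹ := by
        rw [hy, hx, ← conj_zpow, ← conj_zpow, hx, hy, ← zpow_mul, ← zpow_mul, mul_comm]
      _ = (y * x) * σ * (y * x)⁻¹ := by group
  calc x⁻¹ * y⁻¹ * x * y * σ = (y * x)⁻¹ * ((x * y) * σ * (x * y)⁻¹) * (x * y) := by group
    _ = σ * (x⁻¹ * y⁻¹ * x * y) := by rw [hxy]; group

omit [Fintype α] [DecidableEq α] in
theorem apply_inv_eq_of_involutive_on {σ x τ : Perm α} (hτ : ∀ d, σ d = d → σ (τ d) = τ d)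
    (hτ2 : ∀ d, τ (τ d) = d) (hx : ∀ d, σ d = d → x d = τ d) {d : α} (hd : σ d = d) :
    x⁻¹ d = τ d := by
  rw [Perm.inv_eq_iff_eq, hx _ (hτ d hd), hτ2]

theorem isPreprimitive_ofFixingSubgroup_of_isCycle_mem {p : ℕ} (hp : p.Prime) {σ : Perm α}
    (hσ : σ.IsCycle) (hσp : σ.support.card = p) (hσG : σ ∈ G) :
    IsPreprimitive (fixingSubgroup G (σ.support : Set α)ᶜ)
      (SubMulAction.ofFixingSubgroup G (σ.support : Set α)ᶜ) := by
  classical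
  have := isPretransitive_of_isCycle_mem hσ hσG
  apply IsPreprimitive.of_prime_card
  convert! hp
  rw [Nat.card_eq_fintype_card, Fintype.card_subtype, ← hσp]
  apply congr_arg
  ext x
  simp [SubMulAction.mem_ofFixingSubgroup_iff]

/-- A subgroup acts primitively on the support, which contains more than half of the points; this
forces primitivity on the whole set. -/
theorem isPreprimitive_of_isCycle_mem [IsPretransitive G α] {p : ℕ} (hp : p.Prime)
    (hcard : Fintype.card α < 2 * p) {σ : Perm α} (hσ : σ.IsCycle) (hσp : σ.support.card = p)
    (hσG : σ ∈ G) : IsPreprimitive G α := by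
  have := isPreprimitive_ofFixingSubgroup_of_isCycle_mem hp hσ hσp hσG
  let f : SubMulAction.ofFixingSubgroup G (σ.support : Set α)ᶜ
      →ₑ[(fixingSubgroup G (σ.support : Set α)ᶜ).subtype] α :=
    { toFun := fun x => x, map_smul' := fun _ _ => rfl }
  refine IsPreprimitive.of_card_lt (f := f) ?_
  have : Set.range f = σ.support := by
    ext x
    constructor
    · rintro ⟨⟨a, ha⟩, rfl⟩
      have h : σ a ≠ a := by simpa [SubMulAction.mem_ofFixingSubgroup_iff] using ha
      exact mem_support.2 h
    · intro hx
      exact ⟨⟨x, by simpa [SubMulAction.mem_ofFixingSubgroup_iff] using hx⟩, rfl⟩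
  rw [this, Set.ncard_coe_finset, hσp, Nat.card_eq_fintype_card]
  exact hcard

/-- A transitive permutation group containing a `p`-cycle for a prime `p` with
`n / 2 < p < n - 2` contains the alternating group (Jordan). -/
theorem alternatingGroup_le_of_isPretransitive_of_isCycle_mem [IsPretransitive G α] {p : ℕ}
    (hp : p.Prime) (hp3 : p ≠ 3) (hcard : Fintype.card α < 2 * p)
    (hcard' : p + 3 ≤ Fintype.card α) {σ : Perm α} (hσ : σ.IsCycle) (hσp : σ.support.card = p)
    (hσG : σ ∈ G) : alternatingGroup α ≤ G := by
  have hG := isPreprimitive_of_isCycle_mem hp hcard hσ hσp hσG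
  have hcompl : σ.supportᶜ.card = Fintype.card α - p := by rw [Finset.card_compl, hσp]
  -- Jordan: primitivity of the stabilizer of the `n - p` fixed points makes `G` even `(n - p +
  -- 1)`-fold transitive. Thus `G` induces every permutation of the fixed points.
  have hmult : IsMultiplyPretransitive G α σ.supportᶜ.card := by
    have hncard : ((σ.support : Set α)ᶜ).ncard = (Fintype.card α - p - 1) + 1 := by
      rw [← Finset.coe_compl, Set.ncard_coe_finset, hcompl]; omega
    have h1 : IsMultiplyPreprimitive G α (Fintype.card α - p - 1 + 2) := by
      refine hG.isMultiplyPreprimitive hncard ?_ ?_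
      · have := hp.two_le
        rw [Nat.card_eq_fintype_card]; omega
      exact isPreprimitive_ofFixingSubgroup_of_isCycle_mem hp hσ hσp hσG
    have h2 := h1.isMultiplyPretransitive
    refine isMultiplyPretransitive_of_le (n := Fintype.card α - p - 1 + 2) ?_ ?_
    · omega
    · have := hp.two_le
      rw [Nat.card_eq_fintype_card]; omega
  obtain ⟨a, b, c, ha, hb, hc, hab, hac, hbc⟩ :=
    Finset.two_lt_card_iff.1 (show 2 < σ.supportᶜ.card by omega)
  rw [Finset.mem_compl, notMem_support] at ha hb hc
  -- A transposition of fixed points is induced by an element of `G` that normalizes the group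
  -- generated by `σ`.
  have key : ∀ e, σ e = e → ∃ y ∈ G, (∀ d, σ d = d → y d = swap a e d) ∧
      (∀ d, σ d = d → σ (swap a e d) = swap a e d) ∧ ∃ i : ℤ, y * σ * y⁻¹ = σ ^ i := by
    intro e he
    have hsw : ∀ d, σ d = d → σ (swap a e d) = swap a e d := by
      intro d hd
      rw [swap_apply_def]
      split_ifs <;> assumption
    obtain ⟨x, hxG, hx⟩ := exists_mem_eqOn_of_isMultiplyPretransitive hmult (swap a e)
    have hx' : ∀ d, σ d = d → x d = swap a e d := fun d hd => hx d (by simpa using hd)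
    obtain ⟨y, hyG, hy, hyσ⟩ := exists_conj_eq_zpow hp hcard (hσ.orderOf.trans hσp) hσG hxG (by
      intro d hd
      rw [apply_inv_eq_of_involutive_on hsw (swap_apply_self a e) hx' hd]
      exact hsw d hd)
    refine ⟨y, hyG, fun d hd => ?_, hsw, hyσ⟩
    rw [hy d (by rw [hx' d hd]; exact hsw d hd), hx' d hd]
  obtain ⟨x, hxG, hx, hbσ, i, hi⟩ := key b hb
  obtain ⟨y, hyG, hy, hcσ, j, hj⟩ := key c hc
  have hcomm := commute_commutator_of_conj_eq_zpow hi hj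
  set g := x⁻¹ * y⁻¹ * x * y with hg
  set τ : Perm α := swap a b * swap a c with hτ
  have hτ3 : τ.IsThreeCycle := isThreeCycle_swap_mul_swap_same hab hac hbc
  have hττ3 := hτ3.isThreeCycle_sq
  have hgG : g ∈ G := G.mul_mem (G.mul_mem (G.mul_mem (G.inv_mem hxG) (G.inv_mem hyG)) hxG) hyG
  have hgτ : ∀ d, σ d = d → g d = (τ * τ) d ∧ σ ((τ * τ) d) = (τ * τ) d := by
    intro d hd
    have h1 := hcσ d hd
    have h2 := hbσ _ h1
    have h3 := hcσ _ h2
    have h4 := hbσ _ h3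
    refine ⟨?_, h4⟩
    simp only [hg, hτ, mul_apply]
    rw [hy d hd, hx _ h1, apply_inv_eq_of_involutive_on hcσ (swap_apply_self a c) hy h2,
      apply_inv_eq_of_involutive_on hbσ (swap_apply_self a b) hx h3]
  have hpow : ∀ m : ℕ, ∀ d, σ d = d → (g ^ m) d = ((τ * τ) ^ m) d ∧
      σ (((τ * τ) ^ m) d) = ((τ * τ) ^ m) d := by
    intro m
    induction m with
    | zero => intro d hd; simpa using hd
    | succ m ih =>
      intro d hd
      obtain ⟨h1, h2⟩ := ih d hd
      rw [pow_succ', pow_succ', mul_apply, mul_apply, h1]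
      exact hgτ _ h2
  have hfix : ∀ d, σ d ≠ d → (τ * τ) d = d := by
    intro d hd
    have h : ∀ e, σ e = e → d ≠ e := fun e he h => hd (h ▸ he)
    have hτd : τ d = d := by
      rw [hτ, mul_apply, swap_apply_of_ne_of_ne (h a ha) (h c hc),
        swap_apply_of_ne_of_ne (h a ha) (h b hb)]
    rw [mul_apply, hτd, hτd]
  -- The commutator `g` acts on the fixed points as the 3-cycle `τ * τ`. It centralizes `σ`, so its
  -- `p`-th power is trivial on the support. As `p ≠ 3`, what remains is a 3-cycle.
  have hgp : g ^ p = (τ * τ) ^ p := by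
    ext d
    by_cases hd : σ d = d
    · exact (hpow p d hd).1
    · rw [hσ.pow_apply_eq_of_commute hcomm hσp hd]
      have : ∀ m : ℕ, ((τ * τ) ^ m) d = d := by
        intro m
        induction m with
        | zero => simp
        | succ m ih => rw [pow_succ, mul_apply, hfix d hd, ih]
      exact (this p).symm
  refine alternatingGroup_le_of_isPreprimitive_of_isThreeCycle_mem hG (g := g ^ p) ?_
    (G.pow_mem hgG p)
  rw [hgp]
  have h3 : (τ * τ) ^ 3 = 1 := by rw [← hττ3.orderOf, pow_orderOf_eq_one]
  have hmod : (τ * τ) ^ p = (τ * τ) ^ (p % 3) := by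
    conv_lhs => rw [← Nat.div_add_mod p 3, pow_add, pow_mul, h3, one_pow, one_mul]
  have hp0 : p % 3 ≠ 0 := fun h =>
    hp3 ((Nat.prime_dvd_prime_iff_eq Nat.prime_three hp).1 (Nat.dvd_of_mod_eq_zero h)).symm
  have hcases : p % 3 = 1 ∨ p % 3 = 2 := by omega
  rcases hcases with h | h
  · rw [hmod, h, pow_one]; exact hττ3
  · rw [hmod, h, pow_two]; exact hττ3.isThreeCycle_sq

end Equiv.Perm

/-! ### A prime between `n` and `2n - 3`, by Erdős's proof of Bertrand's postulate. -/

section Real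

open Real

theorem Bertrand.real_main_inequality_of_extra_factor {x : ℝ} (x_large : (512 : ℝ) ≤ x) :
    x * (2 * x) * (2 * x) ^ √(2 * x) * 4 ^ (2 * x / 3) ≤ 4 ^ x := by
  let f : ℝ → ℝ := fun x => log x + log x + log 2 + √(2 * x) * log (2 * x) - log 4 / 3 * x
  have hf' : ∀ x, 0 < x → 0 < x * (2 * x) * (2 * x) ^ √(2 * x) / 4 ^ (x / 3) := fun x h =>
    div_pos (mul_pos (mul_pos h (mul_pos two_pos h)) (rpow_pos_of_pos (mul_pos two_pos h) _))
      (rpow_pos_of_pos four_pos _)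
  have hf : ∀ x, 0 < x → f x = log (x * (2 * x) * (2 * x) ^ √(2 * x) / 4 ^ (x / 3)) := by
    intro x h5
    have h6 := mul_pos (zero_lt_two' ℝ) h5
    have h7 := rpow_pos_of_pos h6 (√(2 * x))
    rw [log_div (mul_pos (mul_pos h5 h6) h7).ne' (rpow_pos_of_pos four_pos _).ne',
      log_mul (mul_pos h5 h6).ne' h7.ne', log_mul h5.ne' h6.ne',
      log_rpow h6, log_rpow zero_lt_four, log_mul two_ne_zero h5.ne']
    simp only [f]
    rw [log_mul two_ne_zero h5.ne']
    ring
  have h5 : 0 < x := lt_of_lt_of_le (by norm_num1) x_large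
  rw [← div_le_one (rpow_pos_of_pos four_pos x), ← div_div_eq_mul_div, ← rpow_sub four_pos, ←
    mul_div 2 x, mul_div_left_comm, ← mul_one_sub, (by norm_num1 : (1 : ℝ) - 2 / 3 = 1 / 3),
    mul_one_div, ← log_nonpos_iff (hf' x h5).le, ← hf x h5]
  have hlog : ConcaveOn ℝ (Set.Ioi 0.5) log :=
    strictConcaveOn_log_Ioi.concaveOn.subset (Set.Ioi_subset_Ioi (by norm_num)) (convex_Ioi 0.5)
  have h : ConcaveOn ℝ (Set.Ioi 0.5) f := by
    apply ConcaveOn.sub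
    · apply ConcaveOn.add
      · exact (hlog.add hlog).add (concaveOn_const _ (convex_Ioi 0.5))
      convert!
        ((strictConcaveOn_sqrt_mul_log_Ioi.concaveOn.comp_linearMap ((2 : ℝ) • LinearMap.id)))
        using 1
      ext x
      simp only [Set.mem_Ioi, Set.mem_preimage, LinearMap.smul_apply,
        LinearMap.id_coe, id_eq, smul_eq_mul]
      rw [← mul_lt_mul_iff_right₀ (two_pos)]
      norm_num1
      rfl
    apply ConvexOn.smul
    · refine div_nonneg (log_nonneg (by norm_num1)) (by norm_num1)
    · exact convexOn_id (convex_Ioi (0.5 : ℝ))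
  suffices ∃ x1 x2, 0.5 < x1 ∧ x1 < x2 ∧ x2 ≤ x ∧ 0 ≤ f x1 ∧ f x2 ≤ 0 by
    obtain ⟨x1, x2, h1, h2, h0, h3, h4⟩ := this
    exact (h.right_le_of_le_left'' h1 ((h1.trans h2).trans_le h0) h2 h0 (h4.trans h3)).trans h4
  -- The doubles 36 and 1024 are perfect squares. A concave function that is nonnegative at 18 and
  -- nonpositive at 512 stays nonpositive from there on.
  refine ⟨18, 512, by norm_num1, by norm_num1, x_large, ?_, ?_⟩
  · have : √(2 * 18 : ℝ) = 6 := (sqrt_eq_iff_mul_self_eq_of_pos (by norm_num1)).mpr (by norm_num1)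
    rw [hf _ (by norm_num1), log_nonneg_iff (by positivity), this, one_le_div (by norm_num1)]
    norm_num1
  · have : √(2 * 512) = 32 :=
      (sqrt_eq_iff_mul_self_eq_of_pos (by norm_num1)).mpr (by norm_num1)
    rw [hf _ (by norm_num1), log_nonpos_iff (hf' _ (by norm_num1)).le, this,
        div_le_one (by positivity)]
    conv in 512 => equals 2 ^ 9 => norm_num1
    conv in 2 * 512 => equals 2 ^ 10 => norm_num1
    conv in 2 * 512 => equals 2 ^ 10 => norm_num1
    conv in 32 => rw [← Nat.cast_ofNat]
    rw [rpow_natCast, ← pow_mul, ← pow_add, ← pow_add]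
    conv in 4 => equals 2 ^ (2 : ℝ) => rw [rpow_two]; norm_num1
    rw [← rpow_mul, ← rpow_natCast]
    on_goal 1 => apply rpow_le_rpow_of_exponent_le
    all_goals norm_num1

end Real

open Nat in
theorem bertrand_main_inequality_of_extra_factor {n : ℕ} (n_large : 512 ≤ n) :
    n * (2 * n) * (2 * n) ^ sqrt (2 * n) * 4 ^ (2 * n / 3) ≤ 4 ^ n := by
  rw [← @cast_le ℝ]
  simp only [cast_mul, cast_pow, ← Real.rpow_natCast, cast_ofNat]
  refine _root_.trans ?_
    (Bertrand.real_main_inequality_of_extra_factor (by exact_mod_cast n_large))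
  gcongr
  · have n2_pos : 0 < 2 * n := by positivity
    exact mod_cast n2_pos
  · exact_mod_cast Real.nat_sqrt_le_real_sqrt
  · norm_num1
  · exact cast_div_le.trans (by norm_cast)

open Nat in
/-- If `2 * n - 1` is the only possible prime between `n` and `2 * n`, then the central binomial
coefficient is small. -/
theorem centralBinom_le_of_no_prime_le_two_mul_sub_three (n : ℕ) (n_large : 4 < n)
    (no_prime : ∀ p : ℕ, p.Prime → n < p → 2 * n - 3 < p) :
    centralBinom n ≤ (2 * n) * ((2 * n) ^ sqrt (2 * n) * 4 ^ (2 * n / 3)) := by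
  have n_pos : 0 < n := by omega
  have n2_pos : 1 ≤ 2 * n := by omega
  let f x := x ^ n.centralBinom.factorization x
  let S := {p ∈ Finset.range (2 * n / 3 + 1) | Nat.Prime p}
  have hfle : ∀ p, f p ≤ 2 * n := fun p => pow_factorization_choose_le (mul_pos two_pos n_pos)
  -- The possible prime `2 * n - 1` costs one extra factor of at most `2 * n`.
  have h0 : centralBinom n = f (2 * n - 1) * ∏ p ∈ Finset.range (2 * n / 3 + 1), f p := by
    rw [← Finset.prod_insert (by rw [Finset.mem_range]; omega)]
    refine (Eq.trans ?_ n.prod_pow_factorization_centralBinom).symm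
    apply Finset.prod_subset
    · intro x hx
      rw [Finset.mem_insert, Finset.mem_range] at hx
      rw [Finset.mem_range]
      omega
    intro x hx h2x
    rw [Finset.mem_insert, Finset.mem_range, not_or] at h2x
    rw [Finset.mem_range] at hx
    by_cases hxp : x.Prime
    · have hxn : x ≤ n := by
        by_contra! hlt
        have h1 := no_prime x hxp hlt
        have h2 : Even x := by
          have : x = 2 * n - 2 ∨ x = 2 * n := by omega
          rcases this with rfl | rfl
          · exact ⟨n - 1, by omega⟩
          · exact ⟨n, by omega⟩
        have := hxp.even_iff.1 h2
        omega
      simp only [f]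
      rw [factorization_centralBinom_of_two_mul_self_lt_three_mul (by omega) hxn (by omega),
        Nat.pow_zero]
    · simp only [f]
      rw [factorization_eq_zero_of_not_prime n.centralBinom hxp, Nat.pow_zero]
  have : ∏ x ∈ S, f x = ∏ x ∈ Finset.range (2 * n / 3 + 1), f x := by
    refine Finset.prod_filter_of_ne fun p _ h => ?_
    contrapose h; dsimp only [f]
    rw [factorization_eq_zero_of_not_prime n.centralBinom h, _root_.pow_zero]
  rw [h0, ← this, ← Finset.prod_filter_mul_prod_filter_not S (· ≤ sqrt (2 * n))]
  refine mul_le_mul' (hfle _) (mul_le_mul' ?_ ?_)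
  · refine (Finset.prod_le_prod' fun p _ => hfle p).trans ?_
    have : (Finset.Icc 1 (sqrt (2 * n))).card = sqrt (2 * n) := by rw [card_Icc, Nat.add_sub_cancel]
    rw [Finset.prod_const]
    refine pow_right_mono₀ n2_pos ((Finset.card_le_card fun x hx => ?_).trans this.le)
    obtain ⟨h1, h2⟩ := Finset.mem_filter.1 hx
    exact Finset.mem_Icc.mpr ⟨(Finset.mem_filter.1 h1).2.one_lt.le, h2⟩
  · refine le_trans ?_ (primorial_le_four_pow (2 * n / 3))
    refine (Finset.prod_le_prod' fun p hp => (?_ : f p ≤ p)).trans ?_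
    · obtain ⟨h1, h2⟩ := Finset.mem_filter.1 hp
      refine (pow_right_mono₀ (Finset.mem_filter.1 h1).2.one_lt.le ?_).trans (pow_one p).le
      exact Nat.factorization_choose_le_one (sqrt_lt'.mp <| not_le.1 h2)
    refine Finset.prod_le_prod_of_subset_of_one_le' (Finset.filter_subset _ _) ?_
    exact fun p hp _ => (Finset.mem_filter.1 hp).2.one_lt.le

/-- A sharpening of Bertrand's postulate. -/
theorem Nat.exists_prime_lt_and_le_two_mul_sub_three (n : ℕ) (hn : 7 ≤ n) :
    ∃ p, p.Prime ∧ n < p ∧ p ≤ 2 * n - 3 := by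
  rcases le_or_gt 512 n with h | h
  · have no_prime : 4 ^ n < n * n.centralBinom :=
      Nat.four_pow_lt_mul_centralBinom n (by omega)
    contrapose! no_prime
    have := centralBinom_le_of_no_prime_le_two_mul_sub_three n (by omega) no_prime
    calc n * n.centralBinom
        ≤ n * ((2 * n) * ((2 * n) ^ sqrt (2 * n) * 4 ^ (2 * n / 3))) := by gcongr
      _ = n * (2 * n) * (2 * n) ^ sqrt (2 * n) * 4 ^ (2 * n / 3) := by ring
      _ ≤ 4 ^ n := bertrand_main_inequality_of_extra_factor h
  have step : ∀ q, q.Prime → n < q → q ≤ 2 * n - 3 → ∃ p, p.Prime ∧ n < p ∧ p ≤ 2 * n - 3 :=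
    fun q h1 h2 h3 => ⟨q, h1, h2, h3⟩
  -- Here `11 = 2 * 7 - 3`, and each later prime is at most `2 * q - 3` for its predecessor `q` in
  -- the list.
  by_cases h1 : n < 11
  · exact step 11 (by norm_num1) h1 (by omega)
  by_cases h2 : n < 19
  · exact step 19 (by norm_num1) h2 (by omega)
  by_cases h3 : n < 31
  · exact step 31 (by norm_num1) h3 (by omega)
  by_cases h4 : n < 59
  · exact step 59 (by norm_num1) h4 (by omega)
  by_cases h5 : n < 113
  · exact step 113 (by norm_num1) h5 (by omega)
  by_cases h6 : n < 223
  · exact step 223 (by norm_num1) h6 (by omega)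
  by_cases h7 : n < 443
  · exact step 443 (by norm_num1) h7 (by omega)
  exact step 883 (by norm_num1) (by omega) (by omega)

/-! ### Newton polygons through valuations at a prime of a Dedekind domain. -/

namespace Ideal

variable {O : Type*} [CommRing O] [IsDedekindDomain O] {P : Ideal O}

theorem mem_pow_iff_le_emultiplicity {x : O} {k : ℕ} :
    x ∈ P ^ k ↔ (k : ℕ∞) ≤ emultiplicity P (span {x}) := by
  rw [← pow_dvd_iff_le_emultiplicity, dvd_span_singleton]

theorem emultiplicity_span_mul [P.IsPrime] (hP : P ≠ ⊥) (x y : O) :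
    emultiplicity P (span {x * y}) = emultiplicity P (span {x}) + emultiplicity P (span {y}) := by
  rw [← span_singleton_mul_span_singleton, emultiplicity_mul (prime_of_isPrime hP inferInstance)]

theorem emultiplicity_span_pow [P.IsPrime] (hP : P ≠ ⊥) (x : O) (k : ℕ) :
    emultiplicity P (span {x ^ k}) = k * emultiplicity P (span {x}) := by
  rw [← span_singleton_pow, emultiplicity_pow (prime_of_isPrime hP inferInstance)]

theorem emultiplicity_span_eq_zero {x : O} : emultiplicity P (span {x}) = 0 ↔ x ∉ P := by
  rw [emultiplicity_eq_zero, dvd_span_singleton]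

omit [IsDedekindDomain O] in
-- Used with `I = P ^ (k + 1)`: a sum with a single term of smallest valuation `k` cannot vanish.
theorem sum_ne_zero_of_notMem {ι : Type*} {s : Finset ι} {T : ι → O} {I : Ideal O}
    {i : ι} (hi : i ∈ s) (hTi : T i ∉ I) (hT : ∀ j ∈ s, j ≠ i → T j ∈ I) :
    ∑ j ∈ s, T j ≠ 0 := by
  classical
  intro h
  rw [← Finset.add_sum_erase s T hi] at h
  refine hTi ?_
  rw [eq_neg_of_add_eq_zero_left h]
  exact I.neg_mem (I.sum_mem fun j hj => hT j (Finset.mem_of_mem_erase hj)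
    (Finset.ne_of_mem_erase hj))

section Term

variable {p e w : ℕ} {α : O}

theorem intCast_mul_pow_mem_pow (hp : emultiplicity P (span {(p : O)}) = e)
    (hα : emultiplicity P (span {α}) = w) {c : ℤ} {a : ℕ} (hc : (p : ℤ) ^ a ∣ c) {j k : ℕ}
    (hk : k ≤ e * a + w * j) : (c : O) * α ^ j ∈ P ^ k := by
  have hpe : (p : O) ∈ P ^ e := mem_pow_iff_le_emultiplicity.2 hp.ge
  have hαw : α ∈ P ^ w := mem_pow_iff_le_emultiplicity.2 hα.ge
  obtain ⟨d, rfl⟩ := hc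
  refine pow_le_pow_right hk ?_
  rw [pow_add, pow_mul, pow_mul]
  push_cast
  exact mul_mem_mul (mul_mem_right _ _ (pow_mem_pow hpe a)) (pow_mem_pow hαw j)

theorem intCast_mul_pow_notMem_pow [P.IsPrime] (hP : P ≠ ⊥)
    (hunit : ∀ d : ℤ, ¬ (p : ℤ) ∣ d → (d : O) ∉ P)
    (hp : emultiplicity P (span {(p : O)}) = e)
    (hα : emultiplicity P (span {α}) = w) {c : ℤ} {a : ℕ} (hc : (p : ℤ) ^ a ∣ c)
    (hc' : ¬ (p : ℤ) ^ (a + 1) ∣ c) {j k : ℕ} (hk : k = e * a + w * j) :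
    (c : O) * α ^ j ∉ P ^ (k + 1) := by
  obtain ⟨d, rfl⟩ := hc
  have hd : ¬ (p : ℤ) ∣ d := fun h => hc' (by rw [pow_succ]; exact mul_dvd_mul_left _ h)
  rw [mem_pow_iff_le_emultiplicity]
  push_cast
  rw [emultiplicity_span_mul hP, emultiplicity_span_mul hP, emultiplicity_span_pow hP,
    emultiplicity_span_pow hP, hp, hα, emultiplicity_span_eq_zero.2 (hunit d hd), add_zero, hk]
  norm_cast
  rw [mul_comm a e, mul_comm j w]
  omega

variable {c : ℕ → ℤ} {n : ℕ}

/-- Valuation of a root in the case of one edge of the Newton polygon, from `(0, 1)` to `(m, 0)`. -/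
theorem eq_mul_of_newton_one_edge [P.IsPrime] (hP : P ≠ ⊥)
    (hunit : ∀ d : ℤ, ¬ (p : ℤ) ∣ d → (d : O) ∉ P)
    (hp : emultiplicity P (span {(p : O)}) = e) (hα : emultiplicity P (span {α}) = w)
    (hw : 0 < w) {m : ℕ} (hmn : m ≤ n) (hdvd : ∀ j < m, (p : ℤ) ∣ c j)
    (h0 : ¬ (p : ℤ) ^ 2 ∣ c 0) (h0' : (p : ℤ) ∣ c 0) (hm : ¬ (p : ℤ) ∣ c m)
    (hroot : ∑ j ∈ Finset.range (n + 1), (c j : O) * α ^ j = 0) : e = m * w := by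
  have hmem := fun (c : ℤ) (a : ℕ) (hc : (p : ℤ) ^ a ∣ c) (j k : ℕ) (hk : k ≤ e * a + w * j) =>
    intCast_mul_pow_mem_pow (P := P) hp hα hc hk
  have hnot := fun (c : ℤ) (a : ℕ) (hc : (p : ℤ) ^ a ∣ c) (hc' : ¬ (p : ℤ) ^ (a + 1) ∣ c)
    (j k : ℕ) (hk : k = e * a + w * j) =>
    intCast_mul_pow_notMem_pow (P := P) hP hunit hp hα hc hc' hk
  by_contra hne
  -- If `e < m * w`, the constant term alone has the smallest valuation; if `e > m * w`, the term of
  -- index `m` does.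
  rcases lt_or_gt_of_ne hne with h | h
  · refine sum_ne_zero_of_notMem (Finset.mem_range.2 n.succ_pos)
      (hnot (c 0) 1 (by simpa using h0') h0 0 e (by simp)) ?_ hroot
    intro j _ hj
    have hj1 : w ≤ w * j := Nat.le_mul_of_pos_right w (by omega)
    by_cases hjm : j < m
    · exact hmem _ 1 (by simpa using hdvd j hjm) _ _ (by omega)
    · have : m * w ≤ w * j := by rw [mul_comm]; exact Nat.mul_le_mul_left w (by omega)
      exact hmem _ 0 (by simp) _ _ (by omega)
  · refine sum_ne_zero_of_notMem (Finset.mem_range.2 (Nat.lt_succ_of_le hmn))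
      (hnot (c m) 0 (by simp) (by simpa using hm) m (m * w) (by rw [mul_comm m]; simp)) ?_ hroot
    intro j _ hj
    by_cases hjm : j < m
    · exact hmem _ 1 (by simpa using hdvd j hjm) _ _ (by omega)
    · have : w * (m + 1) ≤ w * j := Nat.mul_le_mul_left w (by omega)
      rw [mul_add, mul_comm w m] at this
      exact hmem _ 0 (by simp) _ _ (by omega)

/-- Valuation of a root in the case of two edges of the Newton polygon, from `(0, 2)` to `(i, 1)`
and from there to `(i + q, 0)`. -/
theorem eq_mul_or_eq_mul_of_newton_two_edges [P.IsPrime] (hP : P ≠ ⊥)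
    (hunit : ∀ d : ℤ, ¬ (p : ℤ) ∣ d → (d : O) ∉ P)
    (hp : emultiplicity P (span {(p : O)}) = e) (hα : emultiplicity P (span {α}) = w)
    (hw : 0 < w) {i q : ℕ} (hi : 0 < i) (hiq : i < q) (hmn : i + q ≤ n)
    (hdvd2 : ∀ j < i, (p : ℤ) ^ 2 ∣ c j) (hdvd : ∀ j < i + q, (p : ℤ) ∣ c j)
    (h0 : ¬ (p : ℤ) ^ 3 ∣ c 0) (hci : ¬ (p : ℤ) ^ 2 ∣ c i) (hm : ¬ (p : ℤ) ∣ c (i + q))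
    (hroot : ∑ j ∈ Finset.range (n + 1), (c j : O) * α ^ j = 0) : e = q * w ∨ e = i * w := by
  have hmem := fun (c : ℤ) (a : ℕ) (hc : (p : ℤ) ^ a ∣ c) (j k : ℕ) (hk : k ≤ e * a + w * j) =>
    intCast_mul_pow_mem_pow (P := P) hp hα hc hk
  have hnot := fun (c : ℤ) (a : ℕ) (hc : (p : ℤ) ^ a ∣ c) (hc' : ¬ (p : ℤ) ^ (a + 1) ∣ c)
    (j k : ℕ) (hk : k = e * a + w * j) =>
    intCast_mul_pow_notMem_pow (P := P) hP hunit hp hα hc hc' hk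
  rw [mul_comm q, mul_comm i]
  have hwiq : w * i + w ≤ w * q := by
    rw [← Nat.mul_succ]; exact Nat.mul_le_mul_left w hiq
  have hstep : ∀ a b : ℕ, a < b → w * a + w ≤ w * b := fun a b hab => by
    rw [← Nat.mul_succ]; exact Nat.mul_le_mul_left w hab
  have hadd : w * (i + q) = w * i + w * q := mul_add _ _ _
  -- It suffices to find the index of a term of strictly smallest valuation.
  have hterm : ∀ k, (∀ j, j < i → j ≠ 0 → k < e * 2 + w * j) → (∀ j, i < j → j < i + q →
      k < e * 1 + w * j) → (∀ j, i + q < j → k < w * j) → ∀ j, j ≠ 0 → j ≠ i → j ≠ i + q →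
      (c j : O) * α ^ j ∈ P ^ (k + 1) := by
    intro k h1 h2 h3 j hj0 hji hjq
    rcases lt_or_gt_of_ne hji with h | h
    · exact hmem _ 2 (hdvd2 j h) _ _ (h1 j h hj0)
    rcases lt_or_gt_of_ne hjq with h' | h'
    · exact hmem _ 1 (by simpa using hdvd j h') _ _ (h2 j h h')
    · exact hmem _ 0 (by simp) _ _ (by have := h3 j h'; omega)
  by_contra! hne
  obtain ⟨hne1, hne2⟩ := hne
  -- The unique smallest term has index `0` if `e < w * i`, index `i` if `w * i < e < w * q`, and
  -- index `i + q` if `e > w * q`.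
  rcases lt_or_gt_of_ne hne2 with h | h
  · refine sum_ne_zero_of_notMem (Finset.mem_range.2 n.succ_pos)
      (hnot (c 0) 2 (hdvd2 0 hi) h0 0 (e * 2) (by simp)) ?_ hroot
    intro j _ hj
    by_cases hji : j = i
    · subst hji
      exact hmem _ 1 (by simpa using hdvd j (by omega)) _ _ (by omega)
    by_cases hjq : j = i + q
    · subst hjq
      exact hmem _ 0 (by simp) _ _ (by omega)
    refine hterm _ (fun j _ hj => ?_) (fun j hj _ => ?_) (fun j hj => ?_) j hj hji hjq
    · have := hstep 0 j (by omega)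
      omega
    · have := hstep i j hj
      omega
    · have := hstep _ j hj
      omega
  · rcases lt_or_gt_of_ne hne1 with h' | h'
    · refine sum_ne_zero_of_notMem (Finset.mem_range.2 (by omega : i < n + 1))
        (hnot (c i) 1 (by simpa using hdvd i (by omega)) hci i (e * 1 + w * i) rfl) ?_ hroot
      intro j _ hji
      by_cases hj : j = 0
      · subst hj
        exact hmem _ 2 (hdvd2 0 hi) _ _ (by omega)
      by_cases hjq : j = i + q
      · subst hjq
        exact hmem _ 0 (by simp) _ _ (by omega)
      refine hterm _ (fun j _ hj => ?_) (fun j hj _ => ?_) (fun j hj => ?_) j hj hji hjq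
      · have := hstep 0 j (by omega)
        omega
      · have := hstep i j hj
        omega
      · have := hstep _ j hj
        omega
    · refine sum_ne_zero_of_notMem (Finset.mem_range.2 (by omega : i + q < n + 1))
        (hnot (c (i + q)) 0 (by simp) (by simpa using hm) (i + q) (w * (i + q)) (by simp)) ?_ hroot
      intro j _ hjq
      by_cases hj : j = 0
      · subst hj
        exact hmem _ 2 (hdvd2 0 hi) _ _ (by omega)
      by_cases hji : j = i
      · subst hji
        exact hmem _ 1 (by simpa using hdvd j (by omega)) _ _ (by omega)
      refine hterm _ (fun j _ hj => ?_) (fun j hj _ => ?_) (fun j hj => ?_) j hj hji hjq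
      · have := hstep 0 j (by omega)
        omega
      · have := hstep i j hj
        omega
      · have := hstep _ j hj
        omega

end Term

section Roots

/-- Each root in `P` contributes valuation `e / i` and the others contribute nothing; the factor `i`
avoids the division. -/
theorem emultiplicity_neg_prod_eq [P.IsPrime] (hP : P ≠ ⊥) {i e : ℕ} [DecidablePred (· ∈ P)]
    (s : Multiset O) (h : ∀ α ∈ s, α ∈ P → i * emultiplicity P (span {α}) = (e : ℕ∞)) :
    i * emultiplicity P (span {(s.map fun α => 0 - α).prod}) =
      (s.countP (· ∈ P) : ℕ∞) * e := by
  induction s using Multiset.induction_on with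
  | empty =>
    have : (1 : O) ∉ P := fun h => IsPrime.ne_top ‹_› ((eq_top_iff_one P).2 h)
    rw [Multiset.map_zero, Multiset.prod_zero, emultiplicity_span_eq_zero.2 this]
    simp
  | cons a s ih =>
    have hs := ih fun α hα => h α (Multiset.mem_cons_of_mem hα)
    have ha : span {0 - a} = span {a} := by rw [zero_sub, span_singleton_neg]
    rw [Multiset.map_cons, Multiset.prod_cons, emultiplicity_span_mul hP, mul_add, hs, ha]
    by_cases haP : a ∈ P
    · rw [Multiset.countP_cons_of_pos _ haP, h a (Multiset.mem_cons_self a s) haP]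
      push_cast
      ring
    · rw [Multiset.countP_cons_of_neg _ haP, emultiplicity_span_eq_zero.2 haP]
      simp

omit [IsDedekindDomain O] in
-- Roots in `P` are those reducing to zero, and the multiplicity of the root zero modulo `P` is the
-- trailing degree.
theorem countP_mem_eq_of_map_eq_prod [P.IsPrime] [DecidablePred (· ∈ P)] {F : ℤ[X]}
    {s : Multiset O} (hs : F.map (algebraMap ℤ O) = (s.map fun α => X - C α).prod) {m : ℕ}
    (h1 : ∀ j < m, (F.coeff j : O) ∈ P) (h2 : (F.coeff m : O) ∉ P) :
    s.countP (· ∈ P) = m := by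
  classical
  have hF : (F.map (algebraMap ℤ O)).map (Ideal.Quotient.mk P) =
      ((s.map (Ideal.Quotient.mk P)).map fun α => X - C α).prod := by
    rw [hs, Polynomial.map_multiset_prod, Multiset.map_map, Multiset.map_map]
    simp
  set g := (F.map (algebraMap ℤ O)).map (Ideal.Quotient.mk P) with hg
  have hcoeff : ∀ j, g.coeff j = Ideal.Quotient.mk P (F.coeff j : O) := fun j => by
    simp [hg]
  have hgm : g.coeff m ≠ 0 := by rwa [hcoeff, Ne, Ideal.Quotient.eq_zero_iff_mem]
  have hm : g.natTrailingDegree = m := by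
    apply le_antisymm (natTrailingDegree_le_of_ne_zero hgm)
    refine le_natTrailingDegree (fun h => hgm (by rw [h, coeff_zero])) fun j hj => ?_
    rw [hcoeff, Ideal.Quotient.eq_zero_iff_mem]
    exact h1 j hj
  rw [← hm, ← rootMultiplicity_eq_natTrailingDegree', ← count_roots, hF,
    roots_multiset_prod_X_sub_C, Multiset.count_map, Multiset.countP_eq_card_filter]
  congr 1
  refine Multiset.filter_congr fun x _ => ?_
  rw [eq_comm, Ideal.Quotient.eq_zero_iff_mem]

omit [IsDedekindDomain O] in
theorem coeff_zero_eq_prod {F : ℤ[X]} {s : Multiset O}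
    (hs : F.map (algebraMap ℤ O) = (s.map fun α => X - C α).prod) :
    (F.coeff 0 : O) = (s.map fun α => 0 - α).prod := by
  have := congrArg (eval 0) hs
  rw [eval_multiset_prod, Multiset.map_map] at this
  simpa [← coeff_zero_eq_eval_zero] using this

omit [IsDedekindDomain O] in
theorem sum_coeff_mul_pow_eq_zero {F : ℤ[X]} {s : Multiset O}
    (hs : F.map (algebraMap ℤ O) = (s.map fun α => X - C α).prod) {α : O} (hα : α ∈ s) :
    ∑ j ∈ Finset.range (F.natDegree + 1), (F.coeff j : O) * α ^ j = 0 := by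
  have h : eval α (F.map (algebraMap ℤ O)) = 0 := by
    rw [hs, eval_multiset_prod, Multiset.map_map]
    refine Multiset.prod_eq_zero (Multiset.mem_map.2 ⟨α, hα, by simp⟩)
  rw [eval_map, eval₂_eq_sum_range] at h
  simpa using h

omit [IsDedekindDomain O] in
theorem exists_mem_of_coeff_zero_mem [P.IsPrime] {F : ℤ[X]} {s : Multiset O}
    (hs : F.map (algebraMap ℤ O) = (s.map fun α => X - C α).prod) (h : (F.coeff 0 : O) ∈ P) :
    ∃ α ∈ s, α ∈ P := by
  rw [coeff_zero_eq_prod hs] at h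
  obtain ⟨a, ha, haP⟩ := (IsPrime.multiset_prod_mem_iff_exists_mem ‹_› _).1 h
  obtain ⟨α, hα, rfl⟩ := Multiset.mem_map.1 ha
  exact ⟨α, hα, by simpa using haP⟩

theorem emultiplicity_span_ne_top [P.IsPrime] (hP : P ≠ ⊥) {x : O} (hx : x ≠ 0) :
    emultiplicity P (span {x}) ≠ ⊤ := by
  rw [← finiteMultiplicity_iff_emultiplicity_ne_top]
  exact FiniteMultiplicity.of_prime_left (prime_of_isPrime hP inferInstance) (by simpa using hx)

end Roots

end Ideal

/-! ### From a Newton edge to the order of the Galois group. -/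

section Ramification

open Ideal NumberField

theorem Polynomial.exists_roots_ringOfIntegers {K : Type*} [Field K] [NumberField K] {F : ℤ[X]}
    (hF : F.Monic) (hs : (F.map (algebraMap ℤ K)).Splits) :
    ∃ s : Multiset (𝓞 K), F.map (algebraMap ℤ (𝓞 K)) = (s.map fun α => X - C α).prod := by
  have hmon : (F.map (algebraMap ℤ K)).Monic := hF.map _
  have hint : ∀ α ∈ (F.map (algebraMap ℤ K)).roots, IsIntegral ℤ α := by
    intro α hα
    refine ⟨F, hF, ?_⟩
    rw [← eval_map]
    exact (mem_roots hmon.ne_zero).1 hα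
  have : CanLift K (𝓞 K) (algebraMap (𝓞 K) K) (IsIntegral ℤ) := ⟨fun x hx => ⟨⟨x, hx⟩, rfl⟩⟩
  obtain ⟨s, hsmap⟩ :=
    (Multiset.canLift (algebraMap (𝓞 K) K) (IsIntegral ℤ)).prf _ hint
  refine ⟨s, Polynomial.map_injective (algebraMap (𝓞 K) K) RingOfIntegers.coe_injective ?_⟩
  rw [Polynomial.map_map, ← IsScalarTower.algebraMap_eq, hs.eq_prod_roots_of_monic hmon, ← hsmap,
    Polynomial.map_multiset_prod, Multiset.map_map, Multiset.map_map]
  simp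

/-- A divisor of the order of `p` at a prime over `p` divides the order of the Galois group. -/
theorem NumberField.dvd_card_gal_of_emultiplicity_eq {K : Type*} [Field K] [NumberField K] [IsGalois ℚ K]
    {p : ℕ} (hp : p.Prime) (P : Ideal (𝓞 K)) [P.IsPrime] [P.LiesOver (span {(p : ℤ)})] {q w : ℕ}
    (h : emultiplicity P (span {(p : 𝓞 K)}) = (q * w : ℕ)) : q ∣ Nat.card Gal(K/ℚ) := by
  have : (span {(p : ℤ)}).IsPrime :=
    (span_singleton_prime (by exact_mod_cast hp.ne_zero)).2 (Nat.prime_iff_prime_int.1 hp)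
  have hmap : Ideal.map (algebraMap ℤ (𝓞 K)) (span {(p : ℤ)}) = span {(p : 𝓞 K)} := by
    rw [Ideal.map_span, Set.image_singleton]
    simp
  have hne : Ideal.map (algebraMap ℤ (𝓞 K)) (span {(p : ℤ)}) ≠ ⊥ := by
    rw [hmap, Ne, span_singleton_eq_bot]
    exact_mod_cast hp.ne_zero
  have : (span {(p : ℤ)}).IsMaximal := IsPrime.isMaximal ‹_› (by
    rw [Ne, span_singleton_eq_bot]; exact_mod_cast hp.ne_zero)
  have he : P.ramificationIdx ℤ = q * w := by
    rw [IsDedekindDomain.ramificationIdx_eq_multiplicity (span {(p : ℤ)}) P hne, hmap]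
    exact multiplicity_eq_of_emultiplicity_eq_some h
  -- In a Galois extension the group order is the product of the number of primes over `p`, the
  -- ramification index and the inertia degree.
  rw [← ncard_primesOver_mul_ramificationIdxIn_mul_inertiaDegIn (span {(p : ℤ)}) (𝓞 K) Gal(K/ℚ),
    ramificationIdxIn_eq_ramificationIdx (span {(p : ℤ)}) P Gal(K/ℚ), he]
  exact Dvd.dvd.mul_left (Dvd.dvd.mul_right (Dvd.intro _ rfl) _) _

variable {F : ℤ[X]} {p : ℕ}

/-- The Newton polygon of `F` at `p` has an edge of length `q` and slope `-1 / q`: either this is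
the first edge, or it is preceded by an edge of slope `-1 / i` with `i < q`. -/
def Polynomial.HasNewtonEdge (F : ℤ[X]) (p q : ℕ) : Prop :=
  (q ≤ F.natDegree ∧ (∀ j < q, (p : ℤ) ∣ F.coeff j) ∧ (p : ℤ) ∣ F.coeff 0 ∧
    ¬ (p : ℤ) ^ 2 ∣ F.coeff 0 ∧ ¬ (p : ℤ) ∣ F.coeff q) ∨
  ∃ i, 0 < i ∧ i < q ∧ i + q ≤ F.natDegree ∧ (∀ j < i, (p : ℤ) ^ 2 ∣ F.coeff j) ∧
    (∀ j < i + q, (p : ℤ) ∣ F.coeff j) ∧ ¬ (p : ℤ) ^ 3 ∣ F.coeff 0 ∧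
    ¬ (p : ℤ) ^ 2 ∣ F.coeff i ∧ ¬ (p : ℤ) ∣ F.coeff (i + q)

theorem Polynomial.HasNewtonEdge.exists_emultiplicity_eq {O : Type*} [CommRing O] [IsDedekindDomain O]
    {P : Ideal O} [P.IsPrime] (hP : P ≠ ⊥)
    (hunit : ∀ d : ℤ, ¬ (p : ℤ) ∣ d → (d : O) ∉ P) (hpP : (p : O) ∈ P) (hp0 : (p : O) ≠ 0)
    {s : Multiset O} (hs : F.map (algebraMap ℤ O) = (s.map fun α => X - C α).prod)
    (h0 : (F.coeff 0 : O) ≠ 0) {q : ℕ} (h : HasNewtonEdge F p q) :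
    ∃ w : ℕ, emultiplicity P (span {(p : O)}) = (q * w : ℕ) := by
  classical
  obtain ⟨e, he⟩ := ENat.ne_top_iff_exists.1 (emultiplicity_span_ne_top hP hp0)
  have hdvd : ∀ d : ℤ, (p : ℤ) ∣ d → (d : O) ∈ P := by
    rintro _ ⟨d, rfl⟩
    push_cast
    exact P.mul_mem_right _ hpP
  have hval : ∀ α ∈ s, α ∈ P → ∃ w : ℕ, emultiplicity P (span {α}) = w ∧ 0 < w := by
    intro α hα hαP
    have hα0 : α ≠ 0 := by
      rintro rfl
      rw [coeff_zero_eq_prod hs] at h0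
      exact h0 (Multiset.prod_eq_zero (Multiset.mem_map.2 ⟨0, hα, sub_zero 0⟩))
    obtain ⟨w, hw⟩ := ENat.ne_top_iff_exists.1 (emultiplicity_span_ne_top hP hα0)
    refine ⟨w, hw.symm, Nat.pos_of_ne_zero ?_⟩
    rintro rfl
    exact emultiplicity_span_eq_zero.1 hw.symm hαP
  rcases h with ⟨hqn, hd, hd0, hd0', hdq⟩ | ⟨i, hi, hiq, hqn, hd2, hd, hd0, hdi, hdq⟩
  · obtain ⟨α, hα, hαP⟩ := exists_mem_of_coeff_zero_mem hs (hdvd _ hd0)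
    obtain ⟨w, hw, hw0⟩ := hval α hα hαP
    refine ⟨w, ?_⟩
    rw [← he, eq_mul_of_newton_one_edge hP hunit he.symm hw hw0 hqn hd hd0' hd0 hdq
      (sum_coeff_mul_pow_eq_zero hs hα)]
  -- Otherwise all `i + q` roots in `P` lie on the first edge, with valuation `e / i`. The constant
  -- coefficient has valuation `2 * e`, so `2 * i = i + q`, against `i < q`.
  · by_contra! hne
    have hall : ∀ α ∈ s, α ∈ P → i * emultiplicity P (span {α}) = (e : ℕ∞) := by
      intro α hα hαP
      obtain ⟨w, hw, hw0⟩ := hval α hα hαP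
      rcases eq_mul_or_eq_mul_of_newton_two_edges hP hunit he.symm hw hw0 hi hiq hqn hd2 hd hd0
        hdi hdq (sum_coeff_mul_pow_eq_zero hs hα) with h | h
      · exact absurd (by rw [← he, h]) (hne w)
      · rw [hw, h]; push_cast; rfl
    have hprod := emultiplicity_neg_prod_eq hP s hall
    rw [← coeff_zero_eq_prod hs, countP_mem_eq_of_map_eq_prod hs (fun j hj => hdvd _ (hd j hj))
      (hunit _ hdq)] at hprod
    have h2 : emultiplicity P (span {(F.coeff 0 : O)}) = (2 * e : ℕ) := by
      obtain ⟨d, hd'⟩ := hd2 0 hi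
      have hpd : ¬ (p : ℤ) ∣ d := fun h => hd0 (by
        rw [hd', pow_succ]; exact mul_dvd_mul_left _ h)
      rw [hd']
      push_cast
      rw [emultiplicity_span_mul hP, emultiplicity_span_pow hP, ← he,
        emultiplicity_span_eq_zero.2 (hunit d hpd), add_zero]
      norm_cast
    rw [h2] at hprod
    have hprod' : i * (2 * e) = (i + q) * e := by exact_mod_cast hprod
    have he0 : 0 < e := by
      refine Nat.pos_of_ne_zero ?_
      rintro rfl
      exact emultiplicity_span_eq_zero.1 he.symm hpP
    have : i * 2 = i + q := Nat.eq_of_mul_eq_mul_right he0 (by rw [mul_assoc, hprod'])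
    omega

theorem Polynomial.HasNewtonEdge.dvd_card_galoisGroup {K : Type*} [Field K] [inst : Algebra ℚ K]
    [FiniteDimensional ℚ K] [IsGalois ℚ K] (hF : F.Monic)
    (hsplit : (F.map (algebraMap ℤ K)).Splits) (hp : p.Prime) (h0 : F.coeff 0 ≠ 0) {q : ℕ}
    (h : HasNewtonEdge F p q) : q ∣ Nat.card Gal(K/ℚ) := by
  have : CharZero K := algebraRat.charZero K
  obtain rfl : inst = DivisionRing.toRatAlgebra := Subsingleton.elim _ _
  have : NumberField K := ⟨⟩
  obtain ⟨s, hs⟩ := exists_roots_ringOfIntegers hF hsplit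
  have hpprime : (span {(p : ℤ)}).IsPrime :=
    (span_singleton_prime (by exact_mod_cast hp.ne_zero)).2 (Nat.prime_iff_prime_int.1 hp)
  obtain ⟨⟨P, _, hPp⟩⟩ := (inferInstance : Nonempty (primesOver (span {(p : ℤ)}) (𝓞 K)))
  have hmem : ∀ d : ℤ, (d : 𝓞 K) ∈ P ↔ (p : ℤ) ∣ d := by
    intro d
    rw [← mem_span_singleton, hPp.over, Ideal.mem_comap]
    simp
  have hpP : (p : 𝓞 K) ∈ P := by exact_mod_cast (hmem p).2 dvd_rfl
  have hp0 : (p : 𝓞 K) ≠ 0 := by exact_mod_cast hp.ne_zero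
  have hP : P ≠ ⊥ := fun h => hp0 (by rwa [h, Ideal.mem_bot] at hpP)
  obtain ⟨w, hw⟩ := h.exists_emultiplicity_eq hP (fun d hd => mt (hmem d).1 hd) hpP hp0 hs
    (by exact_mod_cast h0)
  exact NumberField.dvd_card_gal_of_emultiplicity_eq (K := K) hp P hw

theorem Polynomial.SplittingField.isGalois {k : Type*} [Field k] [PerfectField k] (f : k[X]) :
    IsGalois k f.SplittingField :=
  have : Normal k f.SplittingField := Normal.of_isSplittingField f
  ⟨⟩

theorem Polynomial.SplittingField.finiteDimensional {k : Type*} [Field k] (f : k[X]) :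
    FiniteDimensional k f.SplittingField :=
  inferInstance

theorem Polynomial.HasNewtonEdge.dvd_card_gal (hF : F.Monic) (hp : p.Prime) (h0 : F.coeff 0 ≠ 0)
    {q : ℕ} (h : HasNewtonEdge F p q) : q ∣ Nat.card (F.map (algebraMap ℤ ℚ)).Gal := by
  refine @HasNewtonEdge.dvd_card_galoisGroup F p (F.map (algebraMap ℤ ℚ)).SplittingField _ _
    (SplittingField.finiteDimensional _) (SplittingField.isGalois _) hF ?_ hp h0 q h
  convert SplittingField.splits (F.map (algebraMap ℤ ℚ)) using 1
  rw [Polynomial.map_map]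
  exact congrArg (fun r => F.map r) (RingHom.ext_int _ _)

end Ramification

/-! ### The Newton polygon of the Laguerre polynomial at `p`. -/

/-- One of `j!` and `(n - j)!` already takes up the only factor `p` of `n!`. -/
theorem Nat.Prime.not_dvd_choose_of_lt_two_mul {p n j : ℕ} (hp : p.Prime) (hn : n < 2 * p)
    (hjn : j ≤ n) (hj : p ≤ j ∨ j + p ≤ n) : ¬ p ∣ n.choose j := by
  intro h
  refine hp.sq_not_dvd_factorial hn ?_
  rw [← Nat.choose_mul_factorial_mul_factorial hjn, pow_two]
  rcases hj with hj | hj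
  · exact Dvd.dvd.mul_right (mul_dvd_mul h (hp.dvd_factorial.2 hj)) _
  · rw [mul_right_comm]
    exact Dvd.dvd.mul_right (mul_dvd_mul h (hp.dvd_factorial.2 (by omega))) _

/-- The integral model of `scaledLaguerre n u`. -/
noncomputable def intScaledLaguerre (n : ℕ) (u : ℤ) : ℤ[X] :=
  ∑ j ∈ Finset.range (n + 1),
    C ((n.choose j : ℤ) * ∏ i ∈ Finset.Icc (j + 1) n, (1 + 2 * (u + (i : ℤ)))) * X ^ j

theorem map_intScaledLaguerre (n : ℕ) (u : ℤ) :
    (intScaledLaguerre n u).map (algebraMap ℤ ℚ) = scaledLaguerre n u := by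
  simp [intScaledLaguerre, scaledLaguerre, Polynomial.map_sum, Polynomial.map_prod,
    show (C 2 : ℚ[X]) = 2 from rfl]

theorem coeff_intScaledLaguerre (n : ℕ) (u : ℤ) (j : ℕ) :
    (intScaledLaguerre n u).coeff j =
      (n.choose j : ℤ) * ∏ i ∈ Finset.Icc (j + 1) n, (1 + 2 * (u + (i : ℤ))) := by
  rw [intScaledLaguerre, finsetSum_coeff]
  simp only [coeff_C_mul_X_pow]
  rw [Finset.sum_ite_eq]
  split_ifs with h
  · rfl
  · rw [Finset.mem_range, not_lt] at h
    rw [Nat.choose_eq_zero_of_lt h, Nat.cast_zero, zero_mul]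

theorem monic_intScaledLaguerre (n : ℕ) (u : ℤ) : (intScaledLaguerre n u).Monic := by
  refine monic_of_natDegree_le_of_coeff_eq_one n ?_ ?_
  · rw [natDegree_le_iff_coeff_eq_zero]
    intro j hj
    rw [coeff_intScaledLaguerre, Nat.choose_eq_zero_of_lt hj, Nat.cast_zero, zero_mul]
  · simp [coeff_intScaledLaguerre]

theorem natDegree_intScaledLaguerre (n : ℕ) (u : ℤ) : (intScaledLaguerre n u).natDegree = n := by
  apply le_antisymm
  · rw [natDegree_le_iff_coeff_eq_zero]
    intro j hj
    rw [coeff_intScaledLaguerre, Nat.choose_eq_zero_of_lt hj, Nat.cast_zero, zero_mul]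
  · apply le_natDegree_of_ne_zero
    simp [coeff_intScaledLaguerre]

theorem coeff_zero_intScaledLaguerre_ne_zero (n : ℕ) (u : ℤ) :
    (intScaledLaguerre n u).coeff 0 ≠ 0 := by
  rw [coeff_intScaledLaguerre, Nat.choose_zero_right, Nat.cast_one, one_mul]
  exact Finset.prod_ne_zero_iff.2 fun i _ => by omega

theorem hasNewtonEdge_intScaledLaguerre {n p : ℕ} {v : ℤ} (hp : p.Prime) (hv : 0 < v)
    (hvn : 2 * v - 1 ≤ n) (hpv : 2 * v - 3 < p) (hp3 : 3 < p) (hpn : p < n) (hnp : n < 2 * p) :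
    (intScaledLaguerre n (-v)).HasNewtonEdge p p := by
  have hpZ : Prime (p : ℤ) := Nat.prime_iff_prime_int.1 hp
  have hodd : p % 2 = 1 := (hp.eq_two_or_odd).resolve_left (by omega)
  -- The index at which the factor equals `p`; the factor `3p` then sits at `i₀ + p`.
  obtain ⟨i₀, hi₀⟩ : ∃ i₀ : ℕ, (2 * i₀ : ℤ) = p + 2 * v - 1 :=
    ⟨((p + 2 * v - 1) / 2).toNat, by omega⟩
  set D : ℕ → ℤ := fun i => 1 + 2 * (-v + (i : ℤ)) with hD
  have hcoeff : ∀ j, (intScaledLaguerre n (-v)).coeff j =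
      (n.choose j : ℤ) * ∏ i ∈ Finset.Icc (j + 1) n, D i := coeff_intScaledLaguerre n (-v)
  have hD0 : D i₀ = p := by simp only [hD]; omega
  have hD1 : D (i₀ + p) = p * 3 := by simp only [hD]; push_cast; omega
  -- The factors are odd. The value `-p` would need `i = i₀ - p < 1`, as `2v - 3 < p`, and `5p`
  -- would need `i = i₀ + 2p > n`.
  have hDdvd : ∀ i, 1 ≤ i → i ≤ n → (p : ℤ) ∣ D i → i = i₀ ∨ i = i₀ + p := by
    intro i hi hin h
    have h2 : (p : ℤ) ∣ 2 * ((i : ℤ) - i₀) := by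
      have h3 : 2 * ((i : ℤ) - i₀) = D i - p := by simp only [hD]; linarith
      rw [h3]
      exact dvd_sub h dvd_rfl
    rcases hpZ.dvd_or_dvd h2 with h3 | ⟨k, hk⟩
    · have := Int.le_of_dvd (by norm_num) h3
      omega
    · have hk0 : -1 < k := by
        by_contra! hk1
        have : (p : ℤ) * k ≤ p * (-1) := mul_le_mul_of_nonneg_left hk1 (by omega)
        omega
      have hk2 : k < 2 := by
        by_contra! hk1
        have : (p : ℤ) * 2 ≤ p * k := mul_le_mul_of_nonneg_left hk1 (by omega)
        omega
      obtain rfl | rfl : k = 0 ∨ k = 1 := by omega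
      · left; omega
      · right; omega
  have hprod : ∀ s : Finset ℕ, (∀ i ∈ s, 1 ≤ i ∧ i ≤ n ∧ i ≠ i₀ ∧ i ≠ i₀ + p) →
      ¬ (p : ℤ) ∣ ∏ i ∈ s, D i := by
    intro s hs h
    obtain ⟨i, his, hi⟩ := hpZ.exists_mem_finset_dvd h
    obtain ⟨h1, h2, h3, h4⟩ := hs i his
    rcases hDdvd i h1 h2 hi with h | h
    exacts [h3 h, h4 h]
  have hpD0 : (p : ℤ) ∣ D i₀ := hD0 ▸ dvd_rfl
  have hpD1 : (p : ℤ) ∣ D (i₀ + p) := hD1 ▸ Dvd.intro _ rfl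
  have hchoose : ∀ j, j ≤ n → p ≤ j ∨ j + p ≤ n → ¬ (p : ℤ) ∣ n.choose j := by
    intro j hj hj' h
    exact hp.not_dvd_choose_of_lt_two_mul hnp hj hj' (by exact_mod_cast h)
  have hp0 : (p : ℤ) ≠ 0 := hpZ.ne_zero
  have h3 : ¬ (p : ℤ) ∣ 3 := fun h => by
    have := Int.le_of_dvd (by norm_num) h
    omega
  -- If `3p` occurs, the polygon runs through `(0, 2)`, `(i₀, 1)` and `(i₀ + p, 0)`, and `n < 2p`
  -- gives `i₀ < p`.
  by_cases hcase : i₀ + p ≤ n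
  · right
    have hdvd2 : ∀ j < i₀, (p : ℤ) ^ 2 ∣ ∏ i ∈ Finset.Icc (j + 1) n, D i := by
      intro j hj
      rw [← Finset.mul_prod_erase _ D (Finset.mem_Icc.2 ⟨hj, by omega⟩), pow_two]
      refine mul_dvd_mul hpD0 (hpD1.trans (Finset.dvd_prod_of_mem D ?_))
      rw [Finset.mem_erase, Finset.mem_Icc]
      omega
    refine ⟨i₀, by omega, by omega, by rw [natDegree_intScaledLaguerre]; exact hcase, ?_, ?_, ?_,
      ?_, ?_⟩
    · intro j hj
      rw [hcoeff]
      exact Dvd.dvd.mul_left (hdvd2 j hj) _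
    · intro j hj
      rw [hcoeff]
      exact Dvd.dvd.mul_left
        (hpD1.trans (Finset.dvd_prod_of_mem D (Finset.mem_Icc.2 ⟨hj, hcase⟩))) _
    · rw [hcoeff, Nat.choose_zero_right, Nat.cast_one, one_mul,
        ← Finset.mul_prod_erase _ D (Finset.mem_Icc.2 (⟨by omega, by omega⟩ : 0 + 1 ≤ i₀ ∧ i₀ ≤ n)),
        ← Finset.mul_prod_erase _ D (a := i₀ + p)
          (by rw [Finset.mem_erase, Finset.mem_Icc]; omega), hD0, hD1, pow_succ, pow_two,
        mul_assoc, mul_dvd_mul_iff_left hp0, mul_assoc, mul_dvd_mul_iff_left hp0]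
      refine hpZ.not_dvd_mul h3 (hprod _ fun i hi => ?_)
      simp only [Finset.mem_erase, Finset.mem_Icc] at hi
      omega
    · rw [hcoeff, ← Finset.mul_prod_erase _ D (a := i₀ + p) (by rw [Finset.mem_Icc]; omega), hD1,
        pow_two, mul_assoc, mul_left_comm, mul_dvd_mul_iff_left hp0]
      refine hpZ.not_dvd_mul (hchoose _ (by omega) (Or.inr hcase)) (hpZ.not_dvd_mul h3
        (hprod _ fun i hi => ?_))
      simp only [Finset.mem_erase, Finset.mem_Icc] at hi
      omega
    · rw [hcoeff]
      refine hpZ.not_dvd_mul (hchoose _ hcase (Or.inl (by omega))) (hprod _ fun i hi => ?_)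
      rw [Finset.mem_Icc] at hi
      omega
  -- Now the edge runs from `(0, 1)` to `(p, 0)`. Parity gives `2v - 1 ≤ p`, hence `i₀ ≤ p`; for `i₀
  -- ≤ j < p` the factor `p` comes from the binomial coefficient.
  · left
    refine ⟨by rw [natDegree_intScaledLaguerre]; omega, ?_, ?_, ?_, ?_⟩
    · intro j hj
      rw [hcoeff]
      by_cases hji : j < i₀
      · exact Dvd.dvd.mul_left
          (hpD0.trans (Finset.dvd_prod_of_mem D (Finset.mem_Icc.2 ⟨hji, by omega⟩))) _
      · refine Dvd.dvd.mul_right ?_ _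
        exact_mod_cast hp.dvd_choose hj (by omega) hpn.le
    · rw [hcoeff]
      exact Dvd.dvd.mul_left
        (hpD0.trans (Finset.dvd_prod_of_mem D (Finset.mem_Icc.2 ⟨by omega, by omega⟩))) _
    · rw [hcoeff, Nat.choose_zero_right, Nat.cast_one, one_mul,
        ← Finset.mul_prod_erase _ D (Finset.mem_Icc.2 (⟨by omega, by omega⟩ : 0 + 1 ≤ i₀ ∧ i₀ ≤ n)),
        hD0, pow_two, mul_dvd_mul_iff_left hp0]
      refine hprod _ fun i hi => ?_
      simp only [Finset.mem_erase, Finset.mem_Icc] at hi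
      omega
    · rw [hcoeff]
      refine hpZ.not_dvd_mul (hchoose _ hpn.le (Or.inl le_rfl)) (hprod _ fun i hi => ?_)
      rw [Finset.mem_Icc] at hi
      omega

/-! ### Conclusion for the Galois group. -/

/-- An irreducible rational polynomial of degree `n` whose Galois group has order divisible by a
prime `p` with `n / 2 < p < n - 2` has Galois group containing the alternating group. -/
theorem galoisGroupContainsAlternating_of_dvd_card {f : ℚ[X]} (hf : Irreducible f) {p : ℕ}
    (hp : p.Prime) (hp3 : p ≠ 3) (hpn : f.natDegree < 2 * p) (hpn' : p + 3 ≤ f.natDegree)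
    (hdvd : p ∣ Nat.card f.Gal) : GaloisGroupContainsAlternating f f.natDegree := by
  classical
  have hcard : Fintype.card (f.rootSet ℂ) = f.natDegree :=
    card_rootSet_eq_natDegree hf.separable (IsAlgClosed.splits _)
  have : Fact p.Prime := ⟨hp⟩
  have hG : p ∣ Nat.card (galoisPermGroup f) := by
    rwa [galoisPermGroup, ← Nat.card_congr
      (MonoidHom.ofInjective (Gal.galActionHom_injective f ℂ)).toEquiv]
  obtain ⟨σ, hσ⟩ := exists_prime_orderOf_dvd_card' p hG
  have hσ' : orderOf (σ : Equiv.Perm (f.rootSet ℂ)) = p := by rw [Subgroup.orderOf_coe, hσ]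
  have hcyc : (σ : Equiv.Perm (f.rootSet ℂ)).IsCycle :=
    Equiv.Perm.isCycle_of_prime_order' (by rw [hσ']; exact hp) (by rw [hσ', hcard]; exact hpn)
  have htrans : MulAction.IsPretransitive (galoisPermGroup f) (f.rootSet ℂ) := by
    refine ⟨fun x y => ?_⟩
    obtain ⟨g, hg⟩ := (Gal.galAction_isPretransitive f ℂ hf).exists_smul_eq x y
    exact ⟨⟨Gal.galActionHom f ℂ g, g, rfl⟩, hg⟩
  have hA := Equiv.Perm.alternatingGroup_le_of_isPretransitive_of_isCycle_mem hp hp3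
    (hcard ▸ hpn) (hcard ▸ hpn') hcyc (hcyc.orderOf.symm.trans hσ') σ.2
  let e : f.rootSet ℂ ≃ Fin f.natDegree := Fintype.equivFinOfCardEq hcard
  refine ⟨e, fun τ hτ => ⟨e.symm.permCongr τ, hA ?_, ?_⟩⟩
  · rw [Equiv.Perm.mem_alternatingGroup, Equiv.Perm.sign_permCongr]
    exact hτ
  · ext x
    simp

theorem lemma3p1 (n : ℕ) (u v : ℤ) (hu : u < 0) (hv : v = -u)
    (hirr : Irreducible (scaledLaguerre n u))
    (hn : max 14 (2 * v - 1) ≤ (n : ℤ))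
    (hp : ∃ p : ℕ, p.Prime ∧ 2 * v - 3 < (p : ℤ) ∧ (p : ℤ) < (n : ℤ) - 2) :
    GaloisGroupContainsAlternating (scaledLaguerre n u) n := by
  obtain ⟨hn14, hnv⟩ := max_le_iff.1 hn
  obtain rfl : u = -v := by omega
  obtain ⟨p, hp, hpv, hpn, hnp⟩ : ∃ p : ℕ, p.Prime ∧ 2 * v - 3 < (p : ℤ) ∧
      (p : ℤ) < (n : ℤ) - 2 ∧ n < 2 * p := by
    obtain ⟨p, hp, hpv, hpn⟩ := hp
    by_cases h : n < 2 * p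
    · exact ⟨p, hp, hpv, hpn, h⟩
    -- The bound `14 ≤ n` gives `7 ≤ n / 2`. Since `p ≤ n / 2 < q`, the lower bound `2v - 3` passes
    -- from `p` to `q`.
    · obtain ⟨q, hq, hq1, hq2⟩ := Nat.exists_prime_lt_and_le_two_mul_sub_three (n / 2) (by omega)
      exact ⟨q, hq, by omega, by omega, by omega⟩
  have hdeg : (scaledLaguerre n (-v)).natDegree = n := by
    rw [← map_intScaledLaguerre, (monic_intScaledLaguerre n (-v)).natDegree_map,
      natDegree_intScaledLaguerre]
  have hedge := hasNewtonEdge_intScaledLaguerre hp (by omega) hnv hpv (by omega) (by omega) hnp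
  have hdvd := hedge.dvd_card_gal (monic_intScaledLaguerre n (-v)) hp
    (coeff_zero_intScaledLaguerre_ne_zero n (-v))
  rw [map_intScaledLaguerre] at hdvd
  have := galoisGroupContainsAlternating_of_dvd_card hirr hp (by omega) (by omega) (by omega) hdvd
  rwa [hdeg] at this
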